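/- Let $\Omega\subset\mathbb{R}^2$ be a closed bounded region with non-empty interior whose boundary consists of finitely many straight line segments, let $Y_1,\dots,Y_K\in\Omega$ ($K\ge 1$) be distinct points, and let $S(X)=\min_k\|X-Y_k\|$ be their Euclidean distance transform. Let $V_k=\{X\in\Omega:\|X-Y_k\|\le\|X-Y_j\|\ \forall j\}$ be the Voronoi cell of $Y_k$ in $\Omega$, and assume that each $V_k$ is star-shaped with respect to $Y_k$ (in particular this holds if every $V_k$ is convex). For an angle $\theta$ let $R_k(\theta)=\sup\{r\ge 0: Y_k+r(\cos\theta,\sin\theta)\in V_k\}$ be the length of the ray of $V_k$ at orientation $\theta$. For $0<\epsilon<\frac12$ put $$\Omega^{\epsilon}=\bigcup_{k=1}^{K}\bigl\{Y_k+r(\cos\theta,\sin\theta):\ 0\le\theta<2\pi,\ \epsilon R_k(\theta)\le r\le(1-\epsilon)R_k(\theta)\bigr\},$$ let $L^{\epsilon}$ be the area of $\Omega^{\epsilon}$ and $l^{\epsilon}=\sqrt{L^{\epsilon}}$. For $\tau>0$ and $(u,v)\in\mathbb{R}^2$ define $$F_{\tau}^{\epsilon}(u,v)=\frac{1}{2\pi\tau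 l^{\epsilon}}\iint_{\Omega^{\epsilon}}\exp\left(\frac{iS(x,y)}{\tau}\right)\exp\left(\frac{-i(ux+vy)}{\tau}\right)dx\,dy,$$ and let $P_{\tau}^{\epsilon}(\tilde r,\omega)=|F_{\tau}^{\epsilon}(\tilde r\cos\omega,\tilde r\sin\omega)|^2$ be the power spectrum in polar coordinates. Then for all $0<\epsilon<\frac12$ and $0<\delta<1$ the following hold. 1. For every $\omega_0\in[0,2\pi)$ and every $0<\Delta<2\pi$, $$\lim_{\tau\to0^+}\int_{\omega_0}^{\omega_0+\Delta}\left\{\int_0^{1-\delta}P_{\tau}^{\epsilon}(\tilde r,\omega)\,\tilde r\,d\tilde r+\int_{1+\delta}^{\infty}P_{\tau}^{\epsilon}(\tilde r,\omega)\,\tilde r\,d\tilde r\right\}d\omega=0.$$ 2. Over all angles, $$\lim_{\tau\to0^+}\int_{0}^{2\pi}\left\{\int_0^{1-\delta}P_{\tau}^{\epsilon}(\tilde r,\omega)\,\tilde r\,d\tilde r+\int_{1+\delta}^{\infty}P_{\tau}^{\epsilon}(\tilde r,\omega)\,\tilde r\,d\tilde r\right\}d\omega=0.$$ -/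

import Mathlib

open Real Set Filter Topology MeasureTheory
open scoped ENNReal

noncomputable section

namespace DistanceTransform

/-- The Euclidean plane. -/
abbrev Plane : Type := EuclideanSpace ℝ (Fin 2)

/-- The unit vector at orientation `θ`. -/
def unitVec (θ : ℝ) : Plane := !₂[Real.cos θ, Real.sin θ]

/-- A closed bounded plane region with non-empty interior whose boundary is composed of
finitely many straight line segments. -/
structure IsPolygonalDomain (Ω : Set Plane) : Prop where
  isCompact : IsCompact Ω
  nonempty_interior : (interior Ω).Nonempty
  frontier_eq : ∃ (n : ℕ) (a b : Fin n → Plane), frontier Ω = ⋃ i, segment ℝ (a i) (b i)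

variable {K : ℕ}

/-- The Euclidean distance transform `S(X) = min_k ‖X - Y_k‖` of the points `Y_k`. -/
def distTransform (Y : Fin K → Plane) (X : Plane) : ℝ := ⨅ k, ‖X - Y k‖

/-- The Voronoi cell of `Y_k` inside `Ω`: the points of `Ω` to which no other `Y_j` is closer.
(This is the cell in its actual position, that is, `Y_k + 𝒟_k`.) -/
def voronoiCell (Ω : Set Plane) (Y : Fin K → Plane) (k : Fin K) : Set Plane :=
  {X ∈ Ω | ∀ j, ‖X - Y k‖ ≤ ‖X - Y j‖}

/-- The length `R_k(θ)` of the ray that starts at `Y_k`, has orientation `θ`, and ends on the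
boundary of the cell of `Y_k`. -/
def rayLength (Ω : Set Plane) (Y : Fin K → Plane) (k : Fin K) (θ : ℝ) : ℝ :=
  sSup {r : ℝ | 0 ≤ r ∧ Y k + r • unitVec θ ∈ voronoiCell Ω Y k}

/-- The region `𝒟_k^ε`, given in polar coordinates by `ε R_k(θ) ≤ r ≤ (1 - ε) R_k(θ)`. -/
def trimmedCell (Ω : Set Plane) (Y : Fin K → Plane) (ε : ℝ) (k : Fin K) : Set Plane :=
  {X | ∃ θ ∈ Ico 0 (2 * π),
    ∃ r ∈ Icc (ε * rayLength Ω Y k θ) ((1 - ε) * rayLength Ω Y k θ), X = r • unitVec θ}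

/-- The region `Ω^ε = ⋃_k (Y_k + 𝒟_k^ε)`. -/
def trimmedDomain (Ω : Set Plane) (Y : Fin K → Plane) (ε : ℝ) : Set Plane :=
  ⋃ k, (fun X => Y k + X) '' trimmedCell Ω Y ε k

/-- The area `L^ε` of `Ω^ε`. -/
def trimmedArea (Ω : Set Plane) (Y : Fin K → Plane) (ε : ℝ) : ℝ :=
  (volume : Measure Plane).real (trimmedDomain Ω Y ε)

/-- The scaled Fourier transform of the complex wave representation `exp (i S / τ)`,
`F_τ^ε(u, v) = 1 / (2 π τ l^ε) ∬_{Ω^ε} exp (i S(x, y) / τ) exp (-i (u x + v y) / τ) dx dy`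
with `l^ε = √(L^ε)`. -/
def waveFourier (Ω : Set Plane) (Y : Fin K → Plane) (ε τ u v : ℝ) : ℂ :=
  ((1 / (2 * π * τ * √(trimmedArea Ω Y ε)) : ℝ) : ℂ) *
    ∫ X in trimmedDomain Ω Y ε,
      Complex.exp (Complex.I * ((distTransform Y X / τ : ℝ) : ℂ)) *
        Complex.exp (-Complex.I * (((u * X 0 + v * X 1) / τ : ℝ) : ℂ))

/-- The power spectrum `P_τ^ε(r̃, ω) = |F_τ^ε(r̃ cos ω, r̃ sin ω)|²` in polar coordinates. -/
def powerSpectrum (Ω : Set Plane) (Y : Fin K → Plane) (ε τ r ω : ℝ) : ℝ :=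
  ‖waveFourier Ω Y ε τ (r * Real.cos ω) (r * Real.sin ω)‖ ^ 2

/-- `∫_0^{1-δ} P_τ^ε(r̃, ω) r̃ dr̃ + ∫_{1+δ}^∞ P_τ^ε(r̃, ω) r̃ dr̃`. The integrands are
non-negative, and the integrals take their values in `[0, ∞]`, so that a divergent integral
counts as `∞`. -/
def radialMassOff (Ω : Set Plane) (Y : Fin K → Plane) (ε δ τ ω : ℝ) : ℝ≥0∞ :=
  (∫⁻ r in Ioo 0 (1 - δ), ENNReal.ofReal (powerSpectrum Ω Y ε τ r ω * r)) +
    ∫⁻ r in Ioi (1 + δ), ENNReal.ofReal (powerSpectrum Ω Y ε τ r ω * r)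

end DistanceTransform

end

/-! For an L²-normalised wave `ψ = L^{-1/2} exp (i S / τ)` on a set `T` of positive finite measure
`L`, the power spectrum is the density of a probability measure on momenta (Plancherel). Its
characteristic function at `t` is the autocorrelation `∫ conj ψ(x) ψ(x + τ t) dx`
(`charFun_momentumMeasure`), whose integrand is `L⁻¹ exp (i (S(x + τ t) - S(x)) / τ)` wherever `x`
and `x + τ t` both lie in `T`. Since `S` is Lipschitz, it is differentiable almost everywhere, and
dominated convergence gives the limit `L⁻¹ ∫_T exp (i ⟨∇S, t⟩)`, the characteristic function of `∇S`
at a uniformly random point of `T` (`tendsto_autocorrelation`). By Lévy's continuity theorem the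
momentum distributions converge weakly to the law of `∇S`. The distance transform satisfies `‖∇S‖ =
1` almost everywhere (`norm_gradient_distTransform`), so the limit law lives on the unit circle. The
momenta at distance at least `δ` from that circle form a closed set, and the portmanteau theorem
makes their mass vanish. Polar coordinates turn this mass into a bound for the radial integrals over
any range of angles. -/

noncomputable section

namespace DistanceTransform

/-! ### Plancherel and the characteristic function of the momentum distribution. -/

section Fourier

open scoped FourierTransform SchwartzMap ComplexConjugate ContDiff RealInnerProductSpace

variable {E : Type*} [NormedAddCommGroup E] [InnerProductSpace ℝ E] [FiniteDimensional ℝ E]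
  [MeasurableSpace E] [BorelSpace E]

/-- On `L¹ ∩ L²` the Fourier transform on `L²` is given by the Fourier integral. -/
theorem coeFn_fourier_toLp {f : E → ℂ} (hf : Integrable f) (hf2 : MemLp f 2) :
    (𝓕 (hf2.toLp f) : Lp ℂ 2 (volume : Measure E)) =ᵐ[volume] 𝓕 f := by
  have hcont : Continuous (𝓕 f) :=
    VectorFourier.fourierIntegral_continuous continuous_fourierChar
      (by exact continuous_inner) hf
  refine ae_eq_of_integral_contDiff_smul_eq
    ((Lp.memLp _).locallyIntegrable (by norm_num)) hcont.locallyIntegrable ?_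
  -- A smooth compactly supported test function is Schwartz, and against Schwartz functions the L²
  -- transform is the distributional one, which moves onto the test function.
  intro g hg hgc
  have hg₁ : HasCompactSupport (Complex.ofRealCLM ∘ g) := hgc.comp_left rfl
  have hg₂ : ContDiff ℝ ∞ (Complex.ofRealCLM ∘ g) := by fun_prop
  set G : 𝓢(E, ℂ) := hg₁.toSchwartzMap hg₂ with hG
  have hGg : ∀ x, G x = (g x : ℂ) := fun x => rfl
  have h1 := congrArg (fun u => u G) (Lp.fourier_toTemperedDistribution_eq (hf2.toLp f))
  simp only [TemperedDistribution.fourier_apply, Lp.toTemperedDistribution_apply, hGg,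
    smul_eq_mul] at h1
  have h2 : ∫ x, (𝓕 G) x * (hf2.toLp f) x = ∫ x, (𝓕 G) x * f x := by
    refine integral_congr_ae ?_
    filter_upwards [hf2.coeFn_toLp] with x hx
    rw [hx]
  have h3 := VectorFourier.integral_fourierIntegral_smul_eq_flip (L := innerₗ E)
    (μ := (volume : Measure E)) (ν := (volume : Measure E)) (f := G) (g := f)
    continuous_fourierChar (by exact continuous_inner) G.integrable hf
  have h4 : ∫ x, (𝓕 G) x * f x = ∫ x, G x * 𝓕 f x := by
    rw [flip_innerₗ] at h3
    simpa only [smul_eq_mul, SchwartzMap.fourier_coe] using! h3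
  simp only [Complex.real_smul]
  rw [← h1, h2, h4]
  simp only [hGg]

theorem fourier_comp_add_right (f : E → ℂ) (h ξ : E) :
    𝓕 (fun x => f (x + h)) ξ = Complex.exp (↑(2 * π * ⟪h, ξ⟫) * Complex.I) * 𝓕 f ξ := by
  have := congrFun (VectorFourier.fourierIntegral_comp_add_right fourierChar
    (volume : Measure E) (innerₗ E) f h) ξ
  simpa only [Circle.smul_def, fourierChar_apply, smul_eq_mul] using! this

/-- Plancherel's theorem for a function and one of its translates. -/
theorem integral_normSq_fourier_mul_exp {f : E → ℂ} (hf : Integrable f) (hf2 : MemLp f 2) (h : E) :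
    ∫ ξ, ((‖𝓕 f ξ‖ ^ 2 : ℝ) : ℂ) * Complex.exp (↑(2 * π * ⟪h, ξ⟫) * Complex.I) =
      ∫ x, conj (f x) * f (x + h) := by
  set g : E → ℂ := fun x => f (x + h) with hgdef
  have hmp : MeasurePreserving (fun x : E => x + h) volume volume :=
    measurePreserving_add_right _ _
  have hg : Integrable g := hf.comp_add_right h
  have hg2 : MemLp g 2 := hf2.comp_measurePreserving hmp
  have key := Lp.inner_fourier_eq (hf2.toLp f) (hg2.toLp g)
  rw [L2.inner_def, L2.inner_def] at key
  have e1 : ∫ ξ, ((‖𝓕 f ξ‖ ^ 2 : ℝ) : ℂ) * Complex.exp (↑(2 * π * ⟪h, ξ⟫) * Complex.I) =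
      ∫ ξ, inner ℂ ((𝓕 (hf2.toLp f) : Lp ℂ 2 (volume : Measure E)) ξ)
        ((𝓕 (hg2.toLp g) : Lp ℂ 2 (volume : Measure E)) ξ) := by
    refine integral_congr_ae ?_
    filter_upwards [coeFn_fourier_toLp hf hf2, coeFn_fourier_toLp hg hg2] with ξ h1 h2
    rw [h1, h2, hgdef, fourier_comp_add_right, RCLike.inner_apply']
    simp only [Complex.ofReal_pow, ← Complex.conj_mul']
    ring
  rw [e1, key]
  refine integral_congr_ae ?_
  filter_upwards [hf2.coeFn_toLp, hg2.coeFn_toLp] with x h1 h2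
  rw [h1, h2, RCLike.inner_apply']

theorem integrable_normSq_fourier {f : E → ℂ} (hf : Integrable f) (hf2 : MemLp f 2) :
    Integrable fun ξ => ‖𝓕 f ξ‖ ^ 2 := by
  have := (Lp.memLp (𝓕 (hf2.toLp f) : Lp ℂ 2 (volume : Measure E))).integrable_norm_pow (p := 2)
    two_ne_zero
  refine this.congr ?_
  filter_upwards [coeFn_fourier_toLp hf hf2] with x hx
  rw [hx]

theorem continuous_fourier {f : E → ℂ} (hf : Integrable f) : Continuous (𝓕 f) :=
  VectorFourier.fourierIntegral_continuous continuous_fourierChar (by exact continuous_inner) hf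

/-- The semiclassical momentum distribution of a wave function `f`. -/
def momentumMeasure (f : E → ℂ) (τ : ℝ) : Measure E :=
  (volume.withDensity fun ξ => ENNReal.ofReal (‖𝓕 f ξ‖ ^ 2)).map fun ξ => (2 * π * τ) • ξ

/-- Since `⟨2πτ ξ, t⟩ = 2π ⟨τ t, ξ⟩`, the character at `t` is exactly the phase produced by a
translation by `τ t`, and Plancherel for translates applies. -/
theorem charFun_momentumMeasure {f : E → ℂ} (hf : Integrable f) (hf2 : MemLp f 2) (τ : ℝ) (t : E) :
    charFun (momentumMeasure f τ) t = ∫ x, conj (f x) * f (x + τ • t) := by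
  have hm : Measurable fun ξ => ENNReal.ofReal (‖𝓕 f ξ‖ ^ 2) := by
    have := (continuous_fourier hf).measurable
    fun_prop
  rw [momentumMeasure, charFun_map_smul, charFun_apply,
    integral_withDensity_eq_integral_toReal_smul hm (by simp),
    ← integral_normSq_fourier_mul_exp hf hf2]
  refine integral_congr_ae (ae_of_all _ fun ξ => ?_)
  simp only [ENNReal.toReal_ofReal (sq_nonneg _), Complex.real_smul, inner_smul_right,
    real_inner_comm, inner_smul_left]
  congr 3
  simp
  ring

theorem momentumMeasure_univ {f : E → ℂ} (hf : Integrable f) (hf2 : MemLp f 2) (τ : ℝ) :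
    momentumMeasure f τ univ = ENNReal.ofReal (∫ x, ‖f x‖ ^ 2) := by
  rw [momentumMeasure, Measure.map_apply (by fun_prop) MeasurableSet.univ, preimage_univ,
    withDensity_apply _ MeasurableSet.univ, setLIntegral_univ,
    ← ofReal_integral_eq_lintegral_ofReal (integrable_normSq_fourier hf hf2)
      (ae_of_all _ fun _ => sq_nonneg _)]
  congr 1
  -- The zero translation gives the ordinary Plancherel identity.
  have := integral_normSq_fourier_mul_exp hf hf2 0
  simp only [inner_zero_left, mul_zero, Complex.ofReal_zero, zero_mul, Complex.exp_zero, mul_one,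
    add_zero, Complex.conj_mul'] at this
  have e : ∀ x, ((‖f x‖ : ℂ)) ^ 2 = ((‖f x‖ ^ 2 : ℝ) : ℂ) := by simp
  simp only [e] at this
  rw [integral_complex_ofReal, integral_complex_ofReal] at this
  exact_mod_cast this

end Fourier

end DistanceTransform
end

noncomputable section

namespace DistanceTransform

/-! ### Weak convergence of momenta to the law of the gradient. -/

section WeakLimit

open scoped FourierTransform ComplexConjugate RealInnerProductSpace NNReal

variable {E : Type*} [NormedAddCommGroup E] [InnerProductSpace ℝ E] [FiniteDimensional ℝ E]
  [MeasurableSpace E] [BorelSpace E]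

/-- The phase function `exp (i S / τ)` on `T`, normalised in `L²`. -/
def normalizedWave (S : E → ℝ) (T : Set E) (τ : ℝ) : E → ℂ :=
  T.indicator fun x => ((√(volume.real T))⁻¹ : ℝ) * Complex.exp (Complex.I * ((S x / τ : ℝ) : ℂ))

theorem norm_exp_I_mul_ofReal (x : ℝ) : ‖Complex.exp (Complex.I * x)‖ = 1 := by
  rw [mul_comm, Complex.norm_exp_ofReal_mul_I]

theorem measurable_normalizedWave {S : E → ℝ} (hS : Continuous S) {T : Set E}
    (hT : MeasurableSet T) (τ : ℝ) : Measurable (normalizedWave S T τ) := by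
  refine Measurable.indicator ?_ hT
  have := hS.measurable
  fun_prop

theorem memLp_normalizedWave {S : E → ℝ} (hS : Continuous S) {T : Set E} (hT : MeasurableSet T)
    (hfin : volume T ≠ ∞) (τ : ℝ) (p : ℝ≥0∞) : MemLp (normalizedWave S T τ) p := by
  rw [normalizedWave, memLp_indicator_iff_restrict hT]
  have : IsFiniteMeasure (volume.restrict T) := ⟨by simpa using hfin.lt_top⟩
  refine MemLp.of_bound (C := (√(volume.real T))⁻¹) ?_ (ae_of_all _ fun x => ?_)
  · have := hS.measurable
    exact Measurable.aestronglyMeasurable (by fun_prop)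
  · rw [norm_mul, norm_exp_I_mul_ofReal, mul_one, Complex.norm_real, Real.norm_eq_abs,
      abs_of_nonneg (by positivity)]

theorem integral_normSq_normalizedWave (S : E → ℝ) {T : Set E} (hT : MeasurableSet T)
    (h0 : volume T ≠ 0) (hfin : volume T ≠ ∞) (τ : ℝ) :
    ∫ x, ‖normalizedWave S T τ x‖ ^ 2 = 1 := by
  have hL : 0 < volume.real T := ENNReal.toReal_pos h0 hfin
  have : (fun x => ‖normalizedWave S T τ x‖ ^ 2) = T.indicator fun _ => (volume.real T)⁻¹ := by
    ext x
    by_cases hx : x ∈ T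
    · simp only [normalizedWave, indicator_of_mem hx]
      rw [norm_mul, norm_exp_I_mul_ofReal, mul_one, Complex.norm_real, norm_inv, inv_pow,
        Real.norm_eq_abs, sq_abs, sq_sqrt hL.le]
    · simp [normalizedWave, hx]
  rw [this, integral_indicator hT, setIntegral_const, smul_eq_mul, mul_inv_cancel₀ hL.ne']

theorem isProbabilityMeasure_momentumMeasure {S : E → ℝ} (hS : Continuous S) {T : Set E}
    (hT : MeasurableSet T) (h0 : volume T ≠ 0) (hfin : volume T ≠ ∞) (τ : ℝ) :
    IsProbabilityMeasure (momentumMeasure (normalizedWave S T τ) τ) :=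
  ⟨by rw [momentumMeasure_univ
    (memLp_one_iff_integrable.1 (memLp_normalizedWave hS hT hfin τ 1))
    (memLp_normalizedWave hS hT hfin τ 2), integral_normSq_normalizedWave S hT h0 hfin,
    ENNReal.ofReal_one]⟩

/-- The amplitudes multiply to `1 / volume T` and the phases subtract; with `h = τ t` the exponent
becomes a difference quotient of `S`. -/
theorem conj_normalizedWave_mul (S : E → ℝ) (T : Set E) (τ : ℝ) (x h : E) :
    conj (normalizedWave S T τ x) * normalizedWave S T τ (x + h) =
      (T ∩ (fun y => y + h) ⁻¹' T).indicator (fun y => ((volume.real T)⁻¹ : ℝ) *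
        Complex.exp (Complex.I * (((S (y + h) - S y) / τ : ℝ) : ℂ))) x := by
  by_cases hx : x ∈ T <;> by_cases hy : x + h ∈ T
  · have : x ∈ T ∩ (fun y => y + h) ⁻¹' T := ⟨hx, hy⟩
    simp only [normalizedWave, indicator_of_mem hx, indicator_of_mem hy, indicator_of_mem this,
      map_mul, ← Complex.exp_conj, Complex.conj_I, Complex.conj_ofReal]
    rw [mul_mul_mul_comm, ← Complex.exp_add, ← Complex.ofReal_mul, ← mul_inv,
      Real.mul_self_sqrt measureReal_nonneg]
    congr 2
    push_cast
    ring
  · have : x ∉ T ∩ (fun y => y + h) ⁻¹' T := fun h => hy h.2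
    simp [normalizedWave, hy]
  · simp [normalizedWave, hx]
  · simp [normalizedWave, hx]

/-- Translations move a set of finite measure continuously. -/
theorem tendsto_measure_diff_translate {T : Set E} (hT : MeasurableSet T) (hfin : volume T ≠ ∞)
    {ι : Type*} {l : Filter ι} {h : ι → E} (hh : Tendsto h l (𝓝 0)) :
    Tendsto (fun n => volume (T \ (fun y => y + h n) ⁻¹' T)) l (𝓝 0) := by
  -- Currying makes translation a continuous family in the compact-open topology, as the continuity
  -- of preimages in measure requires.
  let F : C(E, C(E, E)) := ContinuousMap.curry ⟨fun p : E × E => p.2 + p.1, by fun_prop⟩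
  have hF : Tendsto (fun n => F (h n)) l (𝓝 (F 0)) := (F.continuous.tendsto 0).comp hh
  have := tendsto_measure_symmDiff_preimage_nhds_zero (μ := (volume : Measure E))
    (ν := (volume : Measure E)) hF
    (Eventually.of_forall fun n => measurePreserving_add_right _ (h n))
    (measurePreserving_add_right _ (0 : E)) hT.nullMeasurableSet hfin
  refine tendsto_of_tendsto_of_tendsto_of_le_of_le tendsto_const_nhds this (fun _ => zero_le)
    fun n => measure_mono ?_
  rintro x ⟨hx, hx'⟩
  exact Or.inr ⟨by simpa [F] using hx, hx'⟩

omit [MeasurableSpace E] [BorelSpace E] in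
theorem tendsto_difference_quotient {S : E → ℝ} {x : E} (hx : DifferentiableAt ℝ S x) (t : E)
    {τ : ℕ → ℝ} (hτ : Tendsto τ atTop (𝓝 0)) (hτ0 : ∀ n, τ n ≠ 0) :
    Tendsto (fun n => (S (x + τ n • t) - S x) / τ n) atTop (𝓝 ⟪gradient S x, t⟫) := by
  have h1 : HasLineDerivAt ℝ S (fderiv ℝ S x t) x t := hx.hasFDerivAt.hasLineDerivAt t
  have h2 := h1.tendsto_slope_zero.comp
    (tendsto_nhdsWithin_iff.2 ⟨hτ, Eventually.of_forall hτ0⟩)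
  have h3 : ⟪gradient S x, t⟫ = fderiv ℝ S x t := by
    simp [gradient]
  rw [h3]
  refine h2.congr fun n => ?_
  simp [div_eq_inv_mul]

theorem measurable_gradient (S : E → ℝ) : Measurable (gradient S) :=
  (InnerProductSpace.toDual ℝ E).symm.continuous.measurable.comp (measurable_fderiv ℝ S)

/-- The autocorrelation of the normalised wave converges to the characteristic function of the
distribution of the gradient of the phase. -/
theorem tendsto_autocorrelation {S : E → ℝ} {C : ℝ≥0} (hS : LipschitzWith C S) {T : Set E}
    (hT : MeasurableSet T) (hfin : volume T ≠ ∞) {τ : ℕ → ℝ} (hτ : Tendsto τ atTop (𝓝 0))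
    (hτ0 : ∀ n, τ n ≠ 0) (t : E) :
    Tendsto (fun n => ∫ x, conj (normalizedWave S T (τ n) x) *
        normalizedWave S T (τ n) (x + τ n • t)) atTop
      (𝓝 (((volume.real T)⁻¹ : ℝ) *
        ∫ x in T, Complex.exp (Complex.I * (⟪gradient S x, t⟫ : ℝ)))) := by
  have hSm := hS.continuous.measurable
  have hfm : IsFiniteMeasure (volume.restrict T) := ⟨by simpa using hfin.lt_top⟩
  set g : ℕ → E → ℂ := fun n x =>
    Complex.exp (Complex.I * (((S (x + τ n • t) - S x) / τ n : ℝ) : ℂ)) with hg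
  have hgm : ∀ n, Measurable (g n) := fun n => by
    have h2 : Measurable fun x => S (x + τ n • t) := hSm.comp (by fun_prop)
    fun_prop
  have hg1 : ∀ n x, ‖g n x‖ = 1 := fun n x => norm_exp_I_mul_ofReal _
  have hgi : ∀ n, Integrable (g n) (volume.restrict T) := fun n =>
    Integrable.of_bound (hgm n).aestronglyMeasurable 1 (ae_of_all _ fun x => (hg1 n x).le)
  set A : ℕ → Set E := fun n => (fun y => y + τ n • t) ⁻¹' T with hA
  have hAm : ∀ n, MeasurableSet (A n) := fun n => hT.preimage (by fun_prop)
  -- The overlap `T ∩ A n` is replaced by the fixed domain `T`, at the cost of an error over `T \ A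
  -- n`, whose measure tends to zero.
  have e1 : ∀ n, ∫ x, conj (normalizedWave S T (τ n) x) * normalizedWave S T (τ n) (x + τ n • t) =
      ((volume.real T)⁻¹ : ℝ) * (∫ x in T, g n x) -
        ((volume.real T)⁻¹ : ℝ) * ∫ x in T \ A n, g n x := fun n => by
    simp only [conj_normalizedWave_mul]
    rw [integral_indicator (hT.inter (hAm n)), integral_const_mul, ← mul_sub]
    congr 1
    rw [eq_sub_iff_add_eq]
    exact integral_inter_add_sdiff (hAm n) (hgi n)
  simp only [e1]
  have lim1 : Tendsto (fun n => ∫ x in T, g n x) atTop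
      (𝓝 (∫ x in T, Complex.exp (Complex.I * (⟪gradient S x, t⟫ : ℝ)))) := by
    refine tendsto_integral_of_dominated_convergence (fun _ => 1)
      (fun n => (hgm n).aestronglyMeasurable) (integrable_const _)
      (fun n => ae_of_all _ fun x => (hg1 n x).le) ?_
    -- Rademacher's theorem supplies pointwise convergence almost everywhere.
    filter_upwards [ae_restrict_of_ae hS.ae_differentiableAt] with x hx
    have := tendsto_difference_quotient hx t hτ hτ0
    exact (Complex.continuous_exp.tendsto _).comp
      (((Complex.continuous_ofReal.tendsto _).comp this).const_mul _)
  have lim2 : Tendsto (fun n => ∫ x in T \ A n, g n x) atTop (𝓝 0) := by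
    have hd := tendsto_measure_diff_translate hT hfin (h := fun n => τ n • t) (l := atTop)
      (by simpa using hτ.smul_const t)
    have hd' := (ENNReal.tendsto_toReal ENNReal.zero_ne_top).comp hd
    refine squeeze_zero_norm (fun n => ?_) hd'
    have hlt : volume (T \ A n) < ∞ := (measure_mono sdiff_subset).trans_lt hfin.lt_top
    simpa [Measure.real] using
      norm_setIntegral_le_of_norm_le_const (C := 1) hlt (fun x _ => (hg1 n x).le)
  simpa using (lim1.const_mul (((volume.real T)⁻¹ : ℝ) : ℂ)).sub
    (lim2.const_mul (((volume.real T)⁻¹ : ℝ) : ℂ))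

/-- In the semiclassical limit the momentum distribution of `exp (i S / τ)` on `T` gives no mass to
closed sets that are avoided by the gradient of `S`. -/
theorem tendsto_momentumMeasure_isClosed {S : E → ℝ} {C : ℝ≥0} (hS : LipschitzWith C S) {T : Set E}
    (hT : MeasurableSet T) (h0 : volume T ≠ 0) (hfin : volume T ≠ ∞) {B : Set E} (hB : IsClosed B)
    (hgrad : ∀ᵐ x ∂volume, gradient S x ∉ B) :
    Tendsto (fun τ => momentumMeasure (normalizedWave S T τ) τ B) (𝓝[>] 0) (𝓝 0) := by
  refine tendsto_of_seq_tendsto fun τ hτ => ?_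
  obtain ⟨hτ, hpos⟩ := tendsto_nhdsWithin_iff.1 hτ
  -- The sequence is positive only eventually; dropping `N` terms makes every scale nonzero.
  obtain ⟨N, hN⟩ := eventually_atTop.1 hpos
  rw [← tendsto_add_atTop_iff_nat N]
  set σ : ℕ → ℝ := fun n => τ (n + N)
  have hσ : Tendsto σ atTop (𝓝 0) := (tendsto_add_atTop_iff_nat N).2 hτ
  have hσ0 : ∀ n, σ n ≠ 0 := fun n => (hN (n + N) (by omega)).ne'
  change Tendsto (fun n => momentumMeasure (normalizedWave S T (σ n)) (σ n) B) atTop (𝓝 0)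
  have hcond : IsProbabilityMeasure (ProbabilityTheory.cond volume T) :=
    ProbabilityTheory.cond_isProbabilityMeasure_of_finite h0 hfin
  have hgm := measurable_gradient S
  let μ : ℕ → ProbabilityMeasure E := fun n =>
    ⟨_, isProbabilityMeasure_momentumMeasure hS.continuous hT h0 hfin (σ n)⟩
  let μ₀ : ProbabilityMeasure E := ⟨(ProbabilityTheory.cond volume T).map (gradient S),
    Measure.isProbabilityMeasure_map hgm.aemeasurable⟩
  have hlim : Tendsto μ atTop (𝓝 μ₀) := by
    -- Lévy's continuity theorem.
    refine ProbabilityMeasure.tendsto_of_tendsto_charFun fun t => ?_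
    have e0 : charFun (μ₀ : Measure E) t = ((volume.real T)⁻¹ : ℝ) *
        ∫ x in T, Complex.exp (Complex.I * (⟪gradient S x, t⟫ : ℝ)) := by
      change charFun ((ProbabilityTheory.cond volume T).map (gradient S)) t = _
      rw [charFun_apply, integral_map hgm.aemeasurable
        (Measurable.aestronglyMeasurable (by fun_prop)), ProbabilityTheory.cond,
        integral_smul_measure, ENNReal.toReal_inv, Complex.real_smul]
      simp only [mul_comm Complex.I]
      rfl
    rw [e0]
    refine (tendsto_autocorrelation hS hT hfin hσ hσ0 t).congr fun n => ?_
    exact (charFun_momentumMeasure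
      (memLp_one_iff_integrable.1 (memLp_normalizedWave hS.continuous hT hfin _ 1))
      (memLp_normalizedWave hS.continuous hT hfin _ 2) _ _).symm
  have hz : (μ₀ : Measure E) B = 0 := by
    change (ProbabilityTheory.cond volume T).map (gradient S) B = 0
    rw [Measure.map_apply hgm hB.measurableSet]
    exact ProbabilityTheory.cond_absolutelyContinuous (measure_eq_zero_iff_ae_notMem.2 hgrad)
  -- Portmanteau bound for closed sets.
  have hls := ProbabilityMeasure.limsup_measure_closed_le_of_tendsto hlim hB
  rw [hz] at hls
  exact tendsto_of_le_liminf_of_limsup_le zero_le hls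

end WeakLimit

end DistanceTransform
end

noncomputable section

namespace DistanceTransform

variable {K : ℕ}

/-! ### The eikonal equation for the distance transform. -/

section EikonalEquation

open scoped RealInnerProductSpace

theorem distTransform_le (Y : Fin K → Plane) (X : Plane) (k : Fin K) :
    distTransform Y X ≤ ‖X - Y k‖ :=
  ciInf_le (Finite.bddBelow_range fun k => ‖X - Y k‖) k

theorem exists_distTransform_eq (hK : 0 < K) (Y : Fin K → Plane) (X : Plane) :
    ∃ k, ‖X - Y k‖ = distTransform Y X :=
  have : Nonempty (Fin K) := ⟨⟨0, hK⟩⟩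
  exists_eq_ciInf_of_finite

theorem lipschitzWith_distTransform (hK : 0 < K) (Y : Fin K → Plane) :
    LipschitzWith 1 (distTransform Y) := by
  refine LipschitzWith.of_le_add fun X Z => ?_
  obtain ⟨k, hk⟩ := exists_distTransform_eq hK Y Z
  refine (distTransform_le Y X k).trans ?_
  rw [← hk, dist_eq_norm, add_comm]
  exact norm_sub_le_norm_sub_add_norm_sub _ _ _

/-- The distance transform solves the eikonal equation `‖∇S‖ = 1`. -/
theorem norm_gradient_distTransform (hK : 0 < K) (Y : Fin K → Plane) {X : Plane}
    (hX : DifferentiableAt ℝ (distTransform Y) X) (hXY : X ∉ range Y) :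
    ‖gradient (distTransform Y) X‖ = 1 := by
  refine le_antisymm ?_ ?_
  · rw [gradient, LinearIsometryEquiv.norm_map]
    exact_mod_cast norm_fderiv_le_of_lipschitz ℝ (lipschitzWith_distTransform hK Y)
  · obtain ⟨k, hk⟩ := exists_distTransform_eq hK Y X
    -- `v` points to a nearest site. After a fraction `t` of the way that site is at distance `(1 -
    -- t) ‖v‖`, so `S` falls at rate at least `‖v‖` along `v`; Cauchy–Schwarz then forces `‖∇S‖ ≥
    -- 1`.
    set v := Y k - X with hv
    have hv0 : 0 < ‖v‖ := norm_pos_iff.2 (sub_ne_zero.2 fun h => hXY ⟨k, h⟩)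
    have hlim := tendsto_difference_quotient hX v
      (τ := fun n : ℕ => 1 / ((n : ℝ) + 1)) tendsto_one_div_add_atTop_nhds_zero_nat
      (fun n => by positivity)
    have hle : ⟪gradient (distTransform Y) X, v⟫ ≤ -‖v‖ := by
      refine le_of_tendsto hlim (Eventually.of_forall fun n => ?_)
      set t : ℝ := 1 / ((n : ℝ) + 1) with ht
      have ht0 : 0 < t := by positivity
      have ht1 : t ≤ 1 := by
        rw [ht, div_le_one (by positivity)]
        linarith [(Nat.cast_nonneg n : (0 : ℝ) ≤ n)]
      rw [div_le_iff₀ ht0, ← hk]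
      have h1 := distTransform_le Y (X + t • v) k
      have h2 : X + t • v - Y k = (1 - t) • (X - Y k) := by
        rw [hv]
        module
      rw [h2, norm_smul, Real.norm_eq_abs, abs_of_nonneg (by linarith)] at h1
      rw [hv, norm_sub_rev (Y k)]
      linarith
    have h3 := abs_real_inner_le_norm (gradient (distTransform Y) X) v
    have h4 := neg_abs_le ⟪gradient (distTransform Y) X, v⟫
    by_contra! h5
    nlinarith

theorem ae_norm_gradient_distTransform (hK : 0 < K) (Y : Fin K → Plane) :
    ∀ᵐ X ∂(volume : Measure Plane), ‖gradient (distTransform Y) X‖ = 1 := by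
  have h : ∀ᵐ X ∂(volume : Measure Plane), X ∉ range Y :=
    measure_eq_zero_iff_ae_notMem.1 ((finite_range Y).measure_zero _)
  filter_upwards [(lipschitzWith_distTransform hK Y).ae_differentiableAt, h] with X h1 h2
  exact norm_gradient_distTransform hK Y h1 h2

end EikonalEquation

/-! ### Boundedness, hence finite area, of the trimmed domain. -/

section TrimmedDomain

theorem norm_unitVec (θ : ℝ) : ‖unitVec θ‖ = 1 := by
  simp [unitVec, EuclideanSpace.norm_eq]

theorem rayLength_nonneg (Ω : Set Plane) (Y : Fin K → Plane) (k : Fin K) (θ : ℝ) :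
    0 ≤ rayLength Ω Y k θ :=
  Real.sSup_nonneg fun _ hr => hr.1

theorem rayLength_le_diam {Ω : Set Plane} (hΩ : Bornology.IsBounded Ω) {Y : Fin K → Plane}
    (hYΩ : ∀ k, Y k ∈ Ω) (k : Fin K) (θ : ℝ) : rayLength Ω Y k θ ≤ Metric.diam Ω := by
  refine Real.sSup_le (fun r hr => ?_) Metric.diam_nonneg
  have := Metric.dist_le_diam_of_mem hΩ hr.2.1 (hYΩ k)
  rwa [dist_eq_norm, add_sub_cancel_left, norm_smul, norm_unitVec, mul_one, Real.norm_eq_abs,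
    abs_of_nonneg hr.1] at this

theorem isBounded_trimmedDomain {Ω : Set Plane} (hΩ : Bornology.IsBounded Ω) {Y : Fin K → Plane}
    (hYΩ : ∀ k, Y k ∈ Ω) {ε : ℝ} (hε : 0 < ε) :
    Bornology.IsBounded (trimmedDomain Ω Y ε) := by
  refine Bornology.isBounded_iUnion.2 fun k =>
    (Metric.isBounded_closedBall (x := Y k) (r := Metric.diam Ω)).subset ?_
  rintro _ ⟨_, ⟨θ, -, r, ⟨hr1, hr2⟩, rfl⟩, rfl⟩
  have h0 := rayLength_nonneg Ω Y k θ
  have h1 := rayLength_le_diam hΩ hYΩ k θ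
  have h2 : 0 ≤ ε * rayLength Ω Y k θ := by positivity
  rw [Metric.mem_closedBall, dist_eq_norm, add_sub_cancel_left, norm_smul, norm_unitVec, mul_one,
    Real.norm_eq_abs, abs_of_nonneg (h2.trans hr1)]
  linarith

end TrimmedDomain

/-! ### The power spectrum as a momentum density. -/

section Spectrum

open scoped FourierTransform RealInnerProductSpace

/-- A measurable hull of the trimmed domain. -/
def hull (Ω : Set Plane) (Y : Fin K → Plane) (ε : ℝ) : Set Plane :=
  toMeasurable volume (trimmedDomain Ω Y ε)

/-- `𝓕` has kernel `exp (-2πi ⟨x, ξ⟩)`, so momentum `(u, v)` is frequency `(u, v) / (2πτ)`. Passing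
to the hull changes neither the area nor the restricted measure, so measurability of the trimmed
domain need not be shown. -/
theorem waveFourier_eq {Ω : Set Plane} {Y : Fin K → Plane} {ε : ℝ}
    (hfin : volume (trimmedDomain Ω Y ε) ≠ ∞) (τ u v : ℝ) :
    waveFourier Ω Y ε τ u v = (((2 * π * τ)⁻¹ : ℝ) : ℂ) *
      𝓕 (normalizedWave (distTransform Y) (hull Ω Y ε) τ)
        ((2 * π * τ)⁻¹ • (!₂[u, v] : Plane)) := by
  have hT : MeasurableSet (hull Ω Y ε) := measurableSet_toMeasurable _ _
  have hL : trimmedArea Ω Y ε = volume.real (hull Ω Y ε) := by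
    rw [trimmedArea, hull, Measure.real, Measure.real, measure_toMeasurable]
  rw [waveFourier, Real.fourier_eq', ← Measure.restrict_toMeasurable hfin, hL]
  change _ * ∫ X in hull Ω Y ε, _ = _
  rw [← integral_indicator hT, ← integral_const_mul, ← integral_const_mul]
  refine integral_congr_ae (ae_of_all _ fun X => ?_)
  by_cases hX : X ∈ hull Ω Y ε
  · simp only [normalizedWave, indicator_of_mem hX, smul_eq_mul]
    have e : ((-2 * π * ⟪X, (2 * π * τ)⁻¹ • (!₂[u, v] : Plane)⟫ : ℝ) : ℂ) * Complex.I =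
        -Complex.I * (((u * X 0 + v * X 1) / τ : ℝ) : ℂ) := by
      have : -2 * π * ⟪X, (2 * π * τ)⁻¹ • (!₂[u, v] : Plane)⟫ = -((u * X 0 + v * X 1) / τ) := by
        rw [inner_smul_right]
        simp only [PiLp.inner_apply, Fin.sum_univ_two]
        simp
        field_simp
      rw [this]
      push_cast
      ring
    rw [e, one_div, mul_inv]
    push_cast
    ring
  · simp [normalizedWave, hX]

theorem continuous_waveFourier {Ω : Set Plane} {Y : Fin K → Plane} (hK : 0 < K) {ε : ℝ}
    (hfin : volume (trimmedDomain Ω Y ε) ≠ ∞) (τ : ℝ) :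
    Continuous fun p : ℝ × ℝ => waveFourier Ω Y ε τ p.1 p.2 := by
  simp only [waveFourier_eq hfin]
  have h1 : Continuous (𝓕 (normalizedWave (distTransform Y) (hull Ω Y ε) τ)) :=
    continuous_fourier (memLp_one_iff_integrable.1 (memLp_normalizedWave
      (lipschitzWith_distTransform hK Y).continuous (measurableSet_toMeasurable _ _)
      (by rwa [measure_toMeasurable]) τ 1))
  have h2 : Continuous fun p : ℝ × ℝ => (2 * π * τ)⁻¹ • (!₂[p.1, p.2] : Plane) := by fun_prop
  exact continuous_const.mul (h1.comp h2)

/-- The power spectrum is the density of the momentum distribution. -/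
theorem setLIntegral_normSq_waveFourier {Ω : Set Plane} {Y : Fin K → Plane} (hK : 0 < K) {ε : ℝ}
    (hfin : volume (trimmedDomain Ω Y ε) ≠ ∞) {τ : ℝ} (hτ : 0 < τ) {B : Set Plane}
    (hB : MeasurableSet B) :
    ∫⁻ p in B, ENNReal.ofReal (‖waveFourier Ω Y ε τ (p 0) (p 1)‖ ^ 2) =
      momentumMeasure (normalizedWave (distTransform Y) (hull Ω Y ε) τ) τ B := by
  set ψ := normalizedWave (distTransform Y) (hull Ω Y ε) τ with hψ
  have hcont : Continuous (𝓕 ψ) :=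
    continuous_fourier (memLp_one_iff_integrable.1 (memLp_normalizedWave
      (lipschitzWith_distTransform hK Y).continuous (measurableSet_toMeasurable _ _)
      (by rwa [measure_toMeasurable]) τ 1))
  have hc : 0 < 2 * π * τ := by positivity
  set c := 2 * π * τ with hcdef
  have hmul : Measurable fun ξ : Plane => c • ξ := by fun_prop
  have hB' : MeasurableSet ((fun ξ : Plane => c • ξ) ⁻¹' B) := hB.preimage hmul
  have hFm : Measurable fun ξ => ENNReal.ofReal (‖𝓕 ψ ξ‖ ^ 2) := by
    have := hcont.measurable
    fun_prop
  rw [momentumMeasure, Measure.map_apply hmul hB, withDensity_apply _ hB',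
    ← lintegral_indicator hB, ← lintegral_indicator hB']
  set k : Plane → ℝ≥0∞ :=
    ((fun ξ : Plane => c • ξ) ⁻¹' B).indicator fun ξ => ENNReal.ofReal (‖𝓕 ψ ξ‖ ^ 2) with hk
  have hkm : Measurable k := hFm.indicator hB'
  have e1 : ∀ p : Plane, B.indicator
      (fun p => ENNReal.ofReal (‖waveFourier Ω Y ε τ (p 0) (p 1)‖ ^ 2)) p =
        ENNReal.ofReal (c⁻¹ ^ 2) * k (c⁻¹ • p) := fun p => by
    by_cases hp : p ∈ B
    · have hp' : c⁻¹ • p ∈ (fun ξ : Plane => c • ξ) ⁻¹' B := by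
        simpa [smul_smul, mul_inv_cancel₀ hc.ne'] using hp
      have e2 : (!₂[p 0, p 1] : Plane) = p := by
        ext i
        fin_cases i <;> rfl
      rw [hk, indicator_of_mem hp, indicator_of_mem hp', waveFourier_eq hfin, e2, norm_mul,
        mul_pow, ENNReal.ofReal_mul (sq_nonneg _), Complex.norm_real, Real.norm_eq_abs, sq_abs]
    · have hp' : c⁻¹ • p ∉ (fun ξ : Plane => c • ξ) ⁻¹' B := by
        simpa [smul_smul, mul_inv_cancel₀ hc.ne'] using hp
      rw [hk, indicator_of_notMem hp, indicator_of_notMem hp', mul_zero]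
  simp only [e1]
  rw [lintegral_const_mul _ (f := fun p : Plane => k (c⁻¹ • p)) (hkm.comp (by fun_prop)),
    ← lintegral_map (μ := (volume : Measure Plane)) hkm (g := fun p : Plane => c⁻¹ • p) (by fun_prop),
    Measure.map_addHaar_smul _ (inv_ne_zero hc.ne'), lintegral_smul_measure, smul_eq_mul,
    ← mul_assoc, ← ENNReal.ofReal_mul (sq_nonneg _)]
  -- In dimension two the Jacobian `c²` cancels the squared prefactor of the transform.
  have : c⁻¹ ^ 2 * |(c⁻¹ ^ Module.finrank ℝ Plane)⁻¹| = 1 := by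
    rw [finrank_euclideanSpace_fin, abs_of_pos (by positivity)]
    field_simp
  rw [this, ENNReal.ofReal_one, one_mul]

end Spectrum

/-! ### Polar coordinates and periodicity in the angle. -/

section Polar

/-- Integration over the plane in polar coordinates. -/
theorem lintegral_plane_polar (g : Plane → ℝ≥0∞) :
    ∫⁻ q in Ioi (0 : ℝ) ×ˢ Ioo (-π) π,
      ENNReal.ofReal q.1 * g !₂[q.1 * Real.cos q.2, q.1 * Real.sin q.2] = ∫⁻ p, g p := by
  have h1 : MeasurePreserving (fun q : ℝ × ℝ => (!₂[q.1, q.2] : Plane)) volume volume :=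
    (PiLp.volume_preserving_toLp (Fin 2)).comp
      (volume_preserving_finTwoArrow ℝ).symm
  -- The coordinate map is a measurable embedding, so the change of variables needs no measurability
  -- of `g`.
  let e : ℝ × ℝ ≃ᵐ Plane := (MeasurableEquiv.finTwoArrow (α := ℝ)).symm.trans
    (MeasurableEquiv.toLp 2 (Fin 2 → ℝ))
  have he : MeasurableEmbedding (fun q : ℝ × ℝ => (!₂[q.1, q.2] : Plane)) :=
    e.measurableEmbedding
  rw [← h1.lintegral_comp_emb he, ← lintegral_comp_polarCoord_symm]
  simp only [polarCoord_target, polarCoord_symm_apply, smul_eq_mul]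

theorem setLIntegral_Ioc_add_period {f : ℝ → ℝ≥0∞} {c : ℝ} (hf : Function.Periodic f c) (a b : ℝ) :
    ∫⁻ x in Ioc (a + c) (b + c), f x = ∫⁻ x in Ioc a b, f x := by
  rw [← lintegral_indicator measurableSet_Ioc, ← lintegral_indicator measurableSet_Ioc,
    ← lintegral_add_right_eq_self _ c]
  refine lintegral_congr fun x => ?_
  by_cases hx : x ∈ Ioc a b
  · have hx' : x + c ∈ Ioc (a + c) (b + c) := by simpa using hx
    rw [indicator_of_mem hx, indicator_of_mem hx', hf]
  · have hx' : x + c ∉ Ioc (a + c) (b + c) := by simpa using hx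
    rw [indicator_of_notMem hx, indicator_of_notMem hx']

/-- The polar chart covers only `(-π, π)`, while an angular window starting in `[0, 2π)` with length
below `2π` stays within `[0, 4π)`; three periods from `-π` contain it. -/
theorem setLIntegral_Ioc_three_periods {f : ℝ → ℝ≥0∞} (hf : Function.Periodic f (2 * π)) :
    ∫⁻ x in Ioc (-π) (5 * π), f x ≤ 3 * ∫⁻ x in Ioc (-π) π, f x := by
  have h1 := setLIntegral_Ioc_add_period hf (-π) π
  have h2 := setLIntegral_Ioc_add_period hf (-π + 2 * π) (π + 2 * π)
  have hsub : Ioc (-π) (5 * π) ⊆ Ioc (-π) π ∪ (Ioc (-π + 2 * π) (π + 2 * π) ∪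
      Ioc (-π + 2 * π + 2 * π) (π + 2 * π + 2 * π)) := by
    rintro x ⟨hx1, hx2⟩
    simp only [mem_union, mem_Ioc]
    grind
  calc ∫⁻ x in Ioc (-π) (5 * π), f x ≤ _ := lintegral_mono_set hsub
    _ ≤ _ := lintegral_union_le _ _ _
    _ ≤ _ := add_le_add le_rfl (lintegral_union_le _ _ _)
    _ = 3 * ∫⁻ x in Ioc (-π) π, f x := by
      rw [h2, h1]
      ring

theorem periodic_radialMassOff (Ω : Set Plane) (Y : Fin K → Plane) (ε δ τ : ℝ) :
    Function.Periodic (radialMassOff Ω Y ε δ τ) (2 * π) := fun ω => by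
  simp only [radialMassOff, powerSpectrum, Real.cos_add_two_pi, Real.sin_add_two_pi]

/-- The momenta whose length differs from `1` by at least `δ`. -/
def offCircle (δ : ℝ) : Set Plane := {p | ‖p‖ ≤ 1 - δ} ∪ {p | 1 + δ ≤ ‖p‖}

theorem isClosed_offCircle (δ : ℝ) : IsClosed (offCircle δ) :=
  (isClosed_le continuous_norm continuous_const).union
    (isClosed_le continuous_const continuous_norm)

theorem setLIntegral_radialMassOff_le {Ω : Set Plane} {Y : Fin K → Plane} (hK : 0 < K) {ε δ : ℝ}
    (hδ : 0 < δ) (hfin : volume (trimmedDomain Ω Y ε) ≠ ∞) (τ : ℝ) :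
    ∫⁻ ω in Ioc (-π) π, radialMassOff Ω Y ε δ τ ω ≤
      ∫⁻ p in offCircle δ, ENNReal.ofReal (‖waveFourier Ω Y ε τ (p 0) (p 1)‖ ^ 2) := by
  -- The radii are enlarged to include the endpoints `1 ± δ`, matching the closed set that
  -- portmanteau needs.
  set J : Set ℝ := Ioi 0 ∩ (Iic (1 - δ) ∪ Ici (1 + δ)) with hJ
  have hJm : MeasurableSet J := measurableSet_Ioi.inter (measurableSet_Iic.union measurableSet_Ici)
  set q : ℝ × ℝ → ℝ≥0∞ := fun z => ENNReal.ofReal (powerSpectrum Ω Y ε τ z.1 z.2 * z.1) with hq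
  have hqm : Measurable q := by
    have h1 : Continuous fun z : ℝ × ℝ => waveFourier Ω Y ε τ (z.1 * Real.cos z.2)
        (z.1 * Real.sin z.2) :=
      (continuous_waveFourier hK hfin τ).comp
        (f := fun z : ℝ × ℝ => (z.1 * Real.cos z.2, z.1 * Real.sin z.2)) (by fun_prop)
    exact ENNReal.measurable_ofReal.comp (((h1.norm.pow 2).mul continuous_fst).measurable)
  have hdisj : Disjoint (Ioo 0 (1 - δ)) (Ioi (1 + δ)) := by
    rw [Set.disjoint_left]
    intro x h1 h2
    have := h1.2
    have := mem_Ioi.1 h2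
    linarith
  have hrad : ∀ ω, radialMassOff Ω Y ε δ τ ω ≤ ∫⁻ r in J, q (r, ω) := fun ω => by
    rw [radialMassOff, ← lintegral_union measurableSet_Ioi hdisj]
    refine lintegral_mono_set ?_
    rintro r (⟨h1, h2⟩ | h2)
    · exact ⟨h1, Or.inl h2.le⟩
    · exact ⟨lt_trans (by linarith) (mem_Ioi.1 h2), Or.inr (mem_Ioi.1 h2).le⟩
  calc ∫⁻ ω in Ioc (-π) π, radialMassOff Ω Y ε δ τ ω
      = ∫⁻ ω in Ioo (-π) π, radialMassOff Ω Y ε δ τ ω := setLIntegral_congr Ioo_ae_eq_Ioc.symm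
    _ ≤ ∫⁻ ω in Ioo (-π) π, ∫⁻ r in J, q (r, ω) := lintegral_mono fun ω => hrad ω
    _ = ∫⁻ z in J ×ˢ Ioo (-π) π, q z := by
      rw [Measure.volume_eq_prod, ← Measure.prod_restrict, lintegral_prod_symm _ hqm.aemeasurable]
    _ = ∫⁻ z in Ioi (0 : ℝ) ×ˢ Ioo (-π) π, (J ×ˢ Ioo (-π) π).indicator q z := by
      rw [setLIntegral_indicator (hJm.prod measurableSet_Ioo), inter_eq_left.2]
      exact prod_mono inter_subset_left le_rfl
    _ ≤ ∫⁻ z in Ioi (0 : ℝ) ×ˢ Ioo (-π) π, ENNReal.ofReal z.1 * (offCircle δ).indicator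
          (fun p => ENNReal.ofReal (‖waveFourier Ω Y ε τ (p 0) (p 1)‖ ^ 2))
          !₂[z.1 * Real.cos z.2, z.1 * Real.sin z.2] := by
      refine lintegral_mono fun z => ?_
      by_cases hz : z ∈ J ×ˢ Ioo (-π) π
      swap
      · rw [indicator_of_notMem hz]
        exact zero_le
      rw [indicator_of_mem hz]
      have hz0 : 0 < z.1 := hz.1.1
      have hnorm : ‖(!₂[z.1 * Real.cos z.2, z.1 * Real.sin z.2] : Plane)‖ = z.1 := by
        have : (!₂[z.1 * Real.cos z.2, z.1 * Real.sin z.2] : Plane) = z.1 • unitVec z.2 := by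
          ext i
          fin_cases i <;> simp [unitVec]
        rw [this, norm_smul, norm_unitVec, mul_one, Real.norm_eq_abs, abs_of_pos hz0]
      have hmem : (!₂[z.1 * Real.cos z.2, z.1 * Real.sin z.2] : Plane) ∈ offCircle δ := by
        rcases hz.1.2 with h | h
        · exact Or.inl (hnorm.le.trans h)
        · exact Or.inr (le_trans h hnorm.ge)
      rw [indicator_of_mem hmem, ← ENNReal.ofReal_mul hz0.le, mul_comm z.1]
      exact le_rfl
    _ = _ := by
      rw [lintegral_plane_polar, lintegral_indicator (isClosed_offCircle δ).measurableSet]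

end Polar

/-! ### Vanishing of the mass off the unit circle. -/

theorem tendsto_setLIntegral_radialMassOff {Ω : Set Plane} (hΩ : Bornology.IsBounded Ω)
    {Y : Fin K → Plane} (hK : 0 < K) (hYΩ : ∀ k, Y k ∈ Ω) {ε δ : ℝ} (hε : 0 < ε) (hδ : 0 < δ)
    {A : Set ℝ} (hA : A ⊆ Ioc (-π) (5 * π)) :
    Tendsto (fun τ : ℝ => ∫⁻ ω in A, radialMassOff Ω Y ε δ τ ω) (𝓝[>] 0) (𝓝 0) := by
  have hfin : volume (trimmedDomain Ω Y ε) ≠ ∞ :=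
    (isBounded_trimmedDomain hΩ hYΩ hε).measure_lt_top.ne
  -- With zero area no probability measure exists, but the prefactor `1 / 0` is `0`, so the spectrum
  -- is identically zero.
  by_cases h0 : volume (trimmedDomain Ω Y ε) = 0
  · have : trimmedArea Ω Y ε = 0 := by simp [trimmedArea, Measure.real, h0]
    simp [radialMassOff, powerSpectrum, waveFourier, this]
  have hgrad : ∀ᵐ X ∂(volume : Measure Plane), gradient (distTransform Y) X ∉ offCircle δ := by
    filter_upwards [ae_norm_gradient_distTransform hK Y] with X hX
    rintro (h | h)
    · rw [mem_ofPred_eq, hX] at h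
      linarith
    · rw [mem_ofPred_eq, hX] at h
      linarith
  have hlim := tendsto_momentumMeasure_isClosed (lipschitzWith_distTransform hK Y)
    (T := hull Ω Y ε) (measurableSet_toMeasurable _ _) (by rwa [hull, measure_toMeasurable])
    (by rwa [hull, measure_toMeasurable]) (isClosed_offCircle δ) hgrad
  have hlim3 := ENNReal.Tendsto.const_mul (a := 3) hlim (Or.inr (by simp))
  rw [mul_zero] at hlim3
  refine tendsto_of_tendsto_of_tendsto_of_le_of_le' tendsto_const_nhds hlim3
    (Eventually.of_forall fun _ => zero_le) ?_
  filter_upwards [self_mem_nhdsWithin] with τ hτ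
  rw [← setLIntegral_normSq_waveFourier hK hfin hτ (isClosed_offCircle δ).measurableSet]
  exact (lintegral_mono_set hA).trans ((setLIntegral_Ioc_three_periods
    (periodic_radialMassOff Ω Y ε δ τ)).trans
      (mul_le_mul_right (setLIntegral_radialMassOff_le hK hδ hfin τ) _))

end DistanceTransform
end
theorem mainTheorem5 {K : ℕ} (hK : 0 < K)
    (Ω : Set DistanceTransform.Plane) (hΩ : DistanceTransform.IsPolygonalDomain Ω)
    (Y : Fin K → DistanceTransform.Plane) (hY : Function.Injective Y)
    (hYΩ : ∀ k, Y k ∈ Ω)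
    (hcell : ∀ k, StarConvex ℝ (Y k) (DistanceTransform.voronoiCell Ω Y k))
    (ε : ℝ) (hε₀ : 0 < ε) (hε₁ : ε < 1 / 2)
    (δ : ℝ) (hδ₀ : 0 < δ) (hδ₁ : δ < 1) :
    (∀ ω₀ ∈ Ico 0 (2 * π), ∀ Δ ∈ Ioo 0 (2 * π),
      Tendsto
        (fun τ : ℝ => ∫⁻ ω in Icc ω₀ (ω₀ + Δ), DistanceTransform.radialMassOff Ω Y ε δ τ ω)
        (𝓝[>] 0) (𝓝 0)) ∧
    Tendsto
      (fun τ : ℝ => ∫⁻ ω in Icc 0 (2 * π), DistanceTransform.radialMassOff Ω Y ε δ τ ω)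
      (𝓝[>] 0) (𝓝 0) := by
  have hb := hΩ.isCompact.isBounded
  have hπ := Real.pi_pos
  refine ⟨fun ω₀ hω₀ Δ hΔ => ?_, ?_⟩
  · refine DistanceTransform.tendsto_setLIntegral_radialMassOff hb hK hYΩ hε₀ hδ₀ fun ω hω => ?_
    have h1 := hω₀.1
    have h2 := hω₀.2
    have h3 := hΔ.2
    have h4 := hω.1
    have h5 := hω.2
    constructor <;> linarith
  · refine DistanceTransform.tendsto_setLIntegral_radialMassOff hb hK hYΩ hε₀ hδ₀ fun ω hω => ?_
    have h4 := hω.1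
    have h5 := hω.2
    constructor <;> linarith
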